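/- Let $n\ge 1$. For $f:\mathbb{R}^n\to\mathbb{R}$ continuous, the Hardy–Littlewood maximal function of $f$ is $$Mf(x)=\sup_{r>0}\frac{1}{|B(x,r)|}\int_{B(x,r)}|f(y)|\,dy\in[0,\infty],\qquad x\in\mathbb{R}^n .$$ A set $E\subset\mathbb{R}^n$ is called tangential if for every $x\in E$ there is an $(n-1)$-dimensional linear subspace $V_x\subset\mathbb{R}^n$ such that, whenever $h_j\to 0$ with $x+h_j\in E$ and $h_j\neq 0$, we have $|h_j^{V_x^\perp}|/|h_j^{V_x}|\to 0$ as $j\to\infty$, where $h_j=h_j^{V_x}+h_j^{V_x^\perp}$ with $h_j^{V_x}\in V_x$ and $h_j^{V_x^\perp}\in V_x^\perp$ (the quotient being $\infty$ if $h_j^{V_x}=0$). A set is called $\sigma$-tangential if it is covered by countably many tangential sets. Theorem. Suppose that $f:\mathbb{R}^n\to\mathbb{R}$ is continuous on $\mathbb{R}^n$ and differentiable at every point outside some $\sigma$-tangential set, and that $Mf\not\equiv\infty$. Then $Mf$ is finite everywhere, continuous on $\mathbb{R}^n$, and differentiable at every point outside some $\sigma$-tangential set. -/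

import Mathlib

open MeasureTheory Filter Topology
open scoped ENNReal

/-- The (centred) Hardy–Littlewood maximal function
`Mf(x) = sup_{r > 0} (1 / |B(x,r)|) ∫_{B(x,r)} |f(y)| dy`, with values in `[0, ∞]`. -/
noncomputable def maximalFunction {n : ℕ} (f : EuclideanSpace ℝ (Fin n) → ℝ)
    (x : EuclideanSpace ℝ (Fin n)) : ℝ≥0∞ :=
  ⨆ (r : ℝ) (_ : 0 < r), ⨍⁻ y in Metric.ball x r, ‖f y‖ₑ ∂volume

/-- `E ⊆ ℝⁿ` is `k`-tangential: at every `x ∈ E` there is a `k`-dimensional linear subspace `V`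
such that for every sequence `h j → 0` with `x + h j ∈ E`, the component of `h j` orthogonal to `V`
is negligible compared with the component in `V`. The little-o form of `|h^⊥| / |h^V| → 0` gives
the intended meaning for vanishing denominators: terms `h j = 0` are harmless, and
`h j` is eventually not a nonzero vector of `Vᗮ`. -/
def IsKTangential {n : ℕ} (k : ℕ) (E : Set (EuclideanSpace ℝ (Fin n))) : Prop :=
  ∀ x ∈ E, ∃ V : Submodule ℝ (EuclideanSpace ℝ (Fin n)), Module.finrank ℝ V = k ∧
    ∀ h : ℕ → EuclideanSpace ℝ (Fin n), (∀ j, x + h j ∈ E) → Tendsto h atTop (𝓝 0) →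
      (fun j => Vᗮ.starProjection (h j)) =o[atTop] (fun j => V.starProjection (h j))

/-- `E` is `σ`-`k`-tangential: it is covered by countably many `k`-tangential sets
(some of which may be empty). -/
def IsSigmaKTangential {n : ℕ} (k : ℕ) (E : Set (EuclideanSpace ℝ (Fin n))) : Prop :=
  ∃ T : ℕ → Set (EuclideanSpace ℝ (Fin n)), (∀ i, IsKTangential k (T i)) ∧ E ⊆ ⋃ i, T i

/-- `σ`-tangential subsets of `ℝⁿ`, `n ≥ 1`: the case `k = n - 1`. -/
def IsSigmaTangential {n : ℕ} (E : Set (EuclideanSpace ℝ (Fin n))) : Prop :=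
  IsSigmaKTangential (n - 1) E

/-! Passing to `F = |f|` loses only the zeros of `f` with nonzero derivative, a tangential set. Let
`g` be the supremum of the averages of `F`, with radii compactified to `[0, ∞]`: radius `0` gives
`F`, and `∞` is active exactly at the minima of `g`, with gradient `0`. By compactness every point
has an active radius.

At a point `x` where `F` is differentiable, each active radius `r` has a gradient `P x r` whose
affine function bounds `g` from below near `x` up to `o(|y - x|)`. It bounds `g y` from above in the
same sense when some active radius at `y` is close to `r`. Hence, if active radii at `y → x`
converge to `r`, then `g y - g x = ⟨P x r, y - x⟩ + o(|y - x|)`.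

If all active gradients at `x` agree, `g` is differentiable there. Otherwise their differences span
a nonzero space `D`. Finitely many pairs of closures of basic open sets of radii are chosen around
pairs whose differences form a basis of `D`, so small that any active radii in them still give
differences spanning `D`. When `y → x` among points with the same pairs, two expansions for each
pair can be subtracted, so `y - x` is asymptotically orthogonal to `D`. These strata are therefore
tangential, and there are countably many because the topology of `[0, ∞]` has a countable basis. -/

/-! ### Tangential sets -/

section Tangential

variable {n : ℕ}

/-- A set is tangential as soon as, at each of its points, some nonzero vector is asymptotically
orthogonal to the set. -/
theorem isKTangential_of_inner_isLittleO (hn : 1 ≤ n) {S : Set (EuclideanSpace ℝ (Fin n))}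
    (h : ∀ x ∈ S, ∃ u : EuclideanSpace ℝ (Fin n), u ≠ 0 ∧
      (fun y => inner ℝ u (y - x)) =o[𝓝[S] x] (fun y => y - x)) :
    IsKTangential (n - 1) S := by
  intro x hx
  obtain ⟨u, hu, ho⟩ := h x hx
  have : Fact (Module.finrank ℝ (EuclideanSpace ℝ (Fin n)) = (n - 1) + 1) :=
    ⟨by rw [finrank_euclideanSpace_fin]; omega⟩
  refine ⟨(Submodule.span ℝ {u})ᗮ, Submodule.finrank_orthogonal_span_singleton hu,
    fun k hk hk0 => ?_⟩
  have htend : Tendsto (fun j => x + k j) atTop (𝓝[S] x) := by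
    refine tendsto_nhdsWithin_iff.2 ⟨?_, Eventually.of_forall hk⟩
    simpa using hk0.const_add x
  have hinner : (fun j => inner ℝ u (k j)) =o[atTop] k := by
    simpa [Function.comp_def] using ho.comp_tendsto htend
  have hproj : (fun j => (Submodule.span ℝ {u})ᗮᗮ.starProjection (k j)) =o[atTop] k := by
    have hj : ∀ j, (Submodule.span ℝ {u})ᗮᗮ.starProjection (k j)
        = inner ℝ u (k j) • ((‖u‖ ^ 2)⁻¹ • u) := fun j => by
      rw [show (Submodule.span ℝ {u})ᗮᗮ.starProjection (k j)
        = (Submodule.span ℝ {u}).starProjection (k j) by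
          simp only [Submodule.orthogonal_orthogonal], Submodule.starProjection_singleton,
        smul_smul]
      simp [div_eq_mul_inv]
    simp only [hj]
    refine Asymptotics.IsBigO.trans_isLittleO
      (Asymptotics.isBigO_of_le' (c := ‖(‖u‖ ^ 2)⁻¹ • u‖) _ fun j => ?_) hinner
    rw [norm_smul, mul_comm]
  -- The component along `u` is `o(k j)`, so `k j` is controlled by what remains, its component in
  -- the hyperplane.
  refine hproj.trans_isBigO (hproj.right_isBigO_sub.trans (Asymptotics.isBigO_of_le _ fun j => ?_))
  rw [sub_eq_of_eq_add (b := (Submodule.span ℝ {u})ᗮᗮ.starProjection (k j))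
    (Submodule.starProjection_add_starProjection_orthogonal (k j)).symm]

theorem IsSigmaTangential.of_countable {ι : Type*} [Countable ι]
    {S : ι → Set (EuclideanSpace ℝ (Fin n))} (hS : ∀ i, IsKTangential (n - 1) (S i)) :
    IsSigmaTangential (⋃ i, S i) := by
  rcases isEmpty_or_nonempty ι with h | h
  · exact ⟨fun _ => ∅, fun _ x hx => hx.elim, by simp⟩
  · obtain ⟨e, he⟩ := exists_surjective_nat ι
    exact ⟨fun k => S (e k), fun k => hS _, by rw [he.iUnion_comp S]⟩

theorem IsSigmaTangential.union {S S' : Set (EuclideanSpace ℝ (Fin n))}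
    (hS : IsSigmaTangential S) (hS' : IsSigmaTangential S') : IsSigmaTangential (S ∪ S') := by
  obtain ⟨A, hA, hSA⟩ := hS
  obtain ⟨B, hB, hSB⟩ := hS'
  obtain ⟨C, hC, hAB⟩ := IsSigmaTangential.of_countable (S := Sum.elim A B)
    (by rintro (i | i); exacts [hA i, hB i])
  refine ⟨C, hC, (Set.union_subset_union hSA hSB).trans (le_trans (le_of_eq ?_) hAB)⟩
  simp [Set.iUnion_sumElim]

/-- The zeros of `f` at which `f` has a nonzero derivative form a tangential set. -/
theorem isKTangential_zeros_fderiv_ne_zero (hn : 1 ≤ n) (f : EuclideanSpace ℝ (Fin n) → ℝ) :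
    IsKTangential (n - 1) {x | f x = 0 ∧ DifferentiableAt ℝ f x ∧ fderiv ℝ f x ≠ 0} := by
  refine isKTangential_of_inner_isLittleO hn fun x ⟨hx, hd, hne⟩ => ?_
  refine ⟨(InnerProductSpace.toDual ℝ _).symm (fderiv ℝ f x), by simpa using hne, ?_⟩
  have := (hd.hasFDerivAt.isLittleO.mono nhdsWithin_le_nhds :
    _ =o[𝓝[{x | f x = 0 ∧ DifferentiableAt ℝ f x ∧ fderiv ℝ f x ≠ 0}] x] _)
  -- Both values of `f` vanish on the set, so the Taylor remainder is minus the linear term.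
  refine this.neg_left.congr' ?_ EventuallyEq.rfl
  filter_upwards [self_mem_nhdsWithin] with y hy
  rw [InnerProductSpace.toDual_symm_apply, hy.1, hx]
  simp

/-- If a function is differentiable off a `σ`-tangential set, so is its absolute
value. -/
theorem exists_isSigmaTangential_differentiableAt_abs (hn : 1 ≤ n)
    {f : EuclideanSpace ℝ (Fin n) → ℝ} {S : Set (EuclideanSpace ℝ (Fin n))}
    (hS : IsSigmaTangential S) (hf : ∀ x ∉ S, DifferentiableAt ℝ f x) :
    ∃ S' : Set (EuclideanSpace ℝ (Fin n)), IsSigmaTangential S' ∧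
      ∀ x ∉ S', DifferentiableAt ℝ (fun y => |f y|) x := by
  refine ⟨S ∪ ⋃ _ : Unit, _, hS.union
    (IsSigmaTangential.of_countable fun _ => isKTangential_zeros_fderiv_ne_zero hn f),
    fun x hx => ?_⟩
  simp only [Set.mem_union, Set.mem_iUnion, Set.mem_ofPred_eq, exists_const, not_or, not_and,
    not_not] at hx
  have hd := hf x hx.1
  by_cases h0 : f x = 0
  · have h := hd.hasFDerivAt
    rw [hx.2 h0 hd] at h
    refine HasFDerivAt.differentiableAt (f' := 0) (.of_isLittleO ?_)
    simpa [h0] using h.isLittleO.norm_left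
  · exact hd.abs h0

end Tangential

/-! ### Differentiability of functions with compact families of gradients -/

section Gradients

variable {E T : Type*} [NormedAddCommGroup E] [InnerProductSpace ℝ E] [TopologicalSpace T]

/-- The span of all differences of vectors `P r`, `r ∈ R`. -/
def differenceSpan (P : T → E) (R : Set T) : Submodule ℝ E :=
  Submodule.span ℝ (Set.range fun q : R × R => P q.1 - P q.2)

/-- `P x r`, for `r ∈ R x`, are the gradients at `x` of a compact family of functions touching `g`
from below at `x`, and the active indices `R y` at nearby points `y` control the growth of `g`. -/
structure HasActiveGradients (g : E → ℝ) (R : E → Set T) (P : E → T → E) (x : E) : Prop where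
  lower : ∀ r ∈ R x, ∀ ε > 0, ∀ᶠ y in 𝓝 x, inner ℝ (P x r) (y - x) - ε * ‖y - x‖ ≤ g y - g x
  upper : ∀ r ∈ R x, ∀ ε > 0, ∀ᶠ q in 𝓝 (x, r), q.2 ∈ R q.1 →
    g q.1 - g x ≤ inner ℝ (P x r) (q.1 - x) + ε * ‖q.1 - x‖
  continuousOn : ContinuousOn (P x) (R x)

/-- By compactness the selected indices converge along `U`; the closed graph makes the limit active
at `x`, and there `lower` and `upper` squeeze `g`. -/
theorem HasActiveGradients.exists_isLittleO [CompactSpace T] {g : E → ℝ} {R : E → Set T}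
    {P : E → T → E} {x : E} (h : HasActiveGradients g R P x)
    (hR : IsClosed {q : E × T | q.2 ∈ R q.1}) {U : Ultrafilter E} (hU : (U : Filter E) ≤ 𝓝 x)
    {K : Set T} (hK : IsClosed K) {s : E → T} (hs : ∀ᶠ y in (U : Filter E), s y ∈ R y ∩ K) :
    ∃ r ∈ R x ∩ K, (fun y => g y - g x - inner ℝ (P x r) (y - x)) =o[(U : Filter E)]
      (fun y => y - x) := by
  obtain ⟨r, -, hr⟩ := isCompact_univ.ultrafilter_le_nhds (U.map s) (by simp)
  have hsr : Tendsto s U (𝓝 r) := hr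
  have hpair : Tendsto (fun y => (y, s y)) U (𝓝 (x, r)) := by
    rw [nhds_prod_eq]; exact Tendsto.prodMk hU hsr
  have hrR : r ∈ R x := hR.mem_of_tendsto hpair (hs.mono fun y hy => hy.1)
  refine ⟨r, ⟨hrR, hK.mem_of_tendsto hsr (hs.mono fun y hy => hy.2)⟩,
    Asymptotics.IsLittleO.of_bound fun ε hε => ?_⟩
  filter_upwards [hU (h.lower r hrR ε hε), hpair.eventually (h.upper r hrR ε hε), hs]
    with y h1 h2 h3
  have := h2 h3.1
  rw [Real.norm_eq_abs, abs_le]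
  constructor <;> linarith

/-- If all active gradients at `x` agree, the function is differentiable at `x`. -/
theorem HasActiveGradients.differentiableAt [CompactSpace T] {g : E → ℝ} {R : E → Set T}
    {P : E → T → E} {x : E} (h : HasActiveGradients g R P x)
    (hR : IsClosed {q : E × T | q.2 ∈ R q.1}) (hne : ∀ y, (R y).Nonempty)
    (hx : differenceSpan (P x) (R x) = ⊥) : DifferentiableAt ℝ g x := by
  obtain ⟨r₀, hr₀⟩ := hne x
  refine HasFDerivAt.differentiableAt (f' := innerSL ℝ (P x r₀)) (.of_isLittleO ?_)
  -- The limiting index may depend on the ultrafilter, but its gradient does not.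
  refine Asymptotics.IsLittleO.of_bound fun ε hε => mem_iff_ultrafilter.2 fun U hU => ?_
  choose s hs using hne
  obtain ⟨r, ⟨hr, -⟩, ho⟩ := h.exists_isLittleO hR hU isClosed_univ
    (Eventually.of_forall fun y => ⟨hs y, Set.mem_univ _⟩)
  have : P x r = P x r₀ := by
    rw [differenceSpan, Submodule.span_eq_bot] at hx
    exact sub_eq_zero.1 (hx _ ⟨(⟨r, hr⟩, ⟨r₀, hr₀⟩), rfl⟩)
  rw [this] at ho
  exact ho.def hε

/-- Points at which the active gradients span exactly the directions seen by a given finite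
family of pairs of index sets. -/
def gradientStratum (R : E → Set T) (P : E → T → E) {k : ℕ} (b : Fin k → Set T × Set T) :
    Set E :=
  {x | differenceSpan (P x) (R x) ≠ ⊥ ∧
    (∀ i, (R x ∩ (b i).1).Nonempty ∧ (R x ∩ (b i).2).Nonempty) ∧
    ∀ s t : Fin k → T, (∀ i, s i ∈ R x ∩ (b i).1) → (∀ i, t i ∈ R x ∩ (b i).2) →
      differenceSpan (P x) (R x) ≤ Submodule.span ℝ (Set.range fun i => P x (s i) - P x (t i))}

/-- Each pair `b i` gives two first-order expansions of the same `g y`. Subtracting them kills `g`,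
and the limiting differences span `differenceSpan (P x) (R x)`. -/
theorem inner_isLittleO_of_mem_gradientStratum [CompactSpace T] {g : E → ℝ} {R : E → Set T}
    {P : E → T → E} {x : E} (h : HasActiveGradients g R P x)
    (hR : IsClosed {q : E × T | q.2 ∈ R q.1}) {k : ℕ} {b : Fin k → Set T × Set T}
    (hb : ∀ i, IsClosed (b i).1 ∧ IsClosed (b i).2) (hx : x ∈ gradientStratum R P b)
    {u : E} (hu : u ∈ differenceSpan (P x) (R x)) :
    (fun y => inner ℝ u (y - x)) =o[𝓝[gradientStratum R P b] x] (fun y => y - x) := by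
  classical
  refine Asymptotics.IsLittleO.of_bound fun ε hε => mem_iff_ultrafilter.2 fun U hU => ?_
  have hUx : (U : Filter E) ≤ 𝓝 x := hU.trans nhdsWithin_le_nhds
  have hmem : ∀ᶠ y in (U : Filter E), y ∈ gradientStratum R P b := hU self_mem_nhdsWithin
  have hsel : ∀ i, ∃ s t : E → T, (∀ y ∈ gradientStratum R P b, s y ∈ R y ∩ (b i).1) ∧
      ∀ y ∈ gradientStratum R P b, t y ∈ R y ∩ (b i).2 := fun i => by
    have h1 : ∀ y, ∃ q : T × T, y ∈ gradientStratum R P b →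
        q.1 ∈ R y ∩ (b i).1 ∧ q.2 ∈ R y ∩ (b i).2 := fun y => by
      by_cases hy : y ∈ gradientStratum R P b
      · obtain ⟨⟨r, hr⟩, ⟨r', hr'⟩⟩ := hy.2.1 i
        exact ⟨(r, r'), fun _ => ⟨hr, hr'⟩⟩
      -- Off the stratum any default index will do.
      · obtain ⟨⟨r, -⟩, -⟩ := hx.2.1 i
        exact ⟨(r, r), fun h => (hy h).elim⟩
    choose q hq using h1
    exact ⟨fun y => (q y).1, fun y => (q y).2, fun y hy => (hq y hy).1, fun y hy => (hq y hy).2⟩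
  choose s t hs ht using hsel
  choose r hr hro using fun i => h.exists_isLittleO hR hUx (hb i).1 (hmem.mono (hs i))
  choose r' hr' hro' using fun i => h.exists_isLittleO hR hUx (hb i).2 (hmem.mono (ht i))
  suffices ho : (fun y => inner ℝ u (y - x)) =o[(U : Filter E)] (fun y => y - x) from ho.def hε
  refine Submodule.span_induction (p := fun u _ =>
    (fun y => inner ℝ u (y - x)) =o[(U : Filter E)] (fun y => y - x)) ?_ ?_ ?_ ?_
    (hx.2.2 r r' hr hr' hu)
  · rintro _ ⟨i, rfl⟩
    refine ((hro' i).sub (hro i)).congr_left fun y => ?_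
    rw [inner_sub_left]; ring
  · simp
  · intro v w _ _ hv hw
    simpa [inner_add_left] using hv.add hw
  · intro a v _ hv
    simpa [inner_smul_left] using hv.const_mul_left a

/-- Linear independence is an open condition: a basis of differences stays independent when its
active indices move slightly, and a dimension count shows that it still spans. -/
theorem exists_mem_gradientStratum [SecondCountableTopology T] [RegularSpace T]
    [FiniteDimensional ℝ E] {R : E → Set T}
    {P : E → T → E} {x : E} (hP : ContinuousOn (P x) (R x))
    (hx : differenceSpan (P x) (R x) ≠ ⊥) :
    ∃ (k : ℕ) (b : Fin k → TopologicalSpace.countableBasis T × TopologicalSpace.countableBasis T),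
      x ∈ gradientStratum R P fun i => (closure ((b i).1 : Set T), closure ((b i).2 : Set T)) := by
  obtain ⟨κ, a, -, hsp, hli⟩ :=
    exists_linearIndependent' ℝ (fun q : R x × R x => P x q.1 - P x q.2)
  have : Finite κ := hli.finite
  have : Fintype κ := Fintype.ofFinite κ
  let c : Fin (Fintype.card κ) → R x × R x := a ∘ (Fintype.equivFin κ).symm
  let v : Fin (Fintype.card κ) → E := fun i => P x (c i).1 - P x (c i).2
  have hv : LinearIndependent ℝ v := hli.comp _ (Fintype.equivFin κ).symm.injective
  have hvsp : Submodule.span ℝ (Set.range v) = differenceSpan (P x) (R x) := by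
    rw [differenceSpan, ← hsp]
    exact congrArg _ ((Fintype.equivFin κ).symm.surjective.range_comp
      ((fun q : R x × R x => P x q.1 - P x q.2) ∘ a))
  obtain ⟨δ, hδ, hball⟩ := Metric.eventually_nhds_iff.1 hv.eventually
  have hnhds : ∀ r ∈ R x, ∃ b : TopologicalSpace.countableBasis T, r ∈ (b : Set T) ∧
      ∀ r' ∈ R x ∩ closure (b : Set T), dist (P x r') (P x r) < δ / 2 := fun r hr => by
    have h1 := Metric.tendsto_nhds.1 (hP r hr) (δ / 2) (half_pos hδ)
    rw [eventually_nhdsWithin_iff] at h1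
    obtain ⟨b, hb, hrb, hsub⟩ :=
      (TopologicalSpace.isBasis_countableBasis T).exists_closure_subset h1
    exact ⟨⟨b, hb⟩, hrb, fun r' hr' => hsub hr'.2 hr'.1⟩
  choose B hrB hB using hnhds
  refine ⟨_, fun i => (B _ (c i).1.2, B _ (c i).2.2), hx, fun i =>
    ⟨⟨_, (c i).1.2, subset_closure (hrB _ _)⟩, ⟨_, (c i).2.2, subset_closure (hrB _ _)⟩⟩,
    fun s t hs ht => ?_⟩
  have hst : LinearIndependent ℝ fun i => P x (s i) - P x (t i) := by
    refine hball ((dist_pi_lt_iff hδ).2 fun i => ?_)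
    have h1 := hB _ (c i).1.2 _ (hs i)
    have h2 := hB _ (c i).2.2 _ (ht i)
    exact (dist_sub_sub_le _ _ _ _).trans_lt (by linarith)
  refine (Submodule.eq_of_le_of_finrank_eq (Submodule.span_le.2 ?_) ?_).ge
  · rintro _ ⟨i, rfl⟩
    exact Submodule.subset_span ⟨(⟨s i, (hs i).1⟩, ⟨t i, (ht i).1⟩), rfl⟩
  · rw [← hvsp, finrank_span_eq_card hst, finrank_span_eq_card hv]

end Gradients

/-- A function with active gradients at all points of `G` is differentiable at the points of `G`
outside some `σ`-tangential set. -/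
theorem exists_isSigmaTangential_of_hasActiveGradients {n : ℕ} (hn : 1 ≤ n) {T : Type*}
    [TopologicalSpace T] [CompactSpace T] [SecondCountableTopology T] [RegularSpace T]
    {g : EuclideanSpace ℝ (Fin n) → ℝ} {R : EuclideanSpace ℝ (Fin n) → Set T}
    {P : EuclideanSpace ℝ (Fin n) → T → EuclideanSpace ℝ (Fin n)}
    (hR : IsClosed {q : EuclideanSpace ℝ (Fin n) × T | q.2 ∈ R q.1})
    (hne : ∀ y, (R y).Nonempty) {G : Set (EuclideanSpace ℝ (Fin n))}
    (h : ∀ x ∈ G, HasActiveGradients g R P x) :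
    ∃ S : Set (EuclideanSpace ℝ (Fin n)), IsSigmaTangential S ∧
      ∀ x ∈ G, x ∉ S → DifferentiableAt ℝ g x := by
  let ι := Σ k : ℕ, Fin k → TopologicalSpace.countableBasis T × TopologicalSpace.countableBasis T
  have : Countable (TopologicalSpace.countableBasis T) :=
    (TopologicalSpace.countable_countableBasis T).to_subtype
  have : Countable ι := inferInstanceAs (Countable (Σ k : ℕ, _))
  let b : ∀ i : ι, Fin i.1 → Set T × Set T := fun i j =>
    (closure ((i.2 j).1 : Set T), closure ((i.2 j).2 : Set T))
  refine ⟨⋃ i : ι, G ∩ gradientStratum R P (b i), IsSigmaTangential.of_countable fun i =>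
    isKTangential_of_inner_isLittleO hn fun x hx => ?_, fun x hxG hx => ?_⟩
  · obtain ⟨u, hu, hu0⟩ := Submodule.exists_mem_ne_zero_of_ne_bot hx.2.1
    exact ⟨u, hu0, (inner_isLittleO_of_mem_gradientStratum (h x hx.1) hR
      (fun _ => ⟨isClosed_closure, isClosed_closure⟩) hx.2 hu).mono
        (nhdsWithin_mono _ Set.inter_subset_right)⟩
  · refine (h x hxG).differentiableAt hR hne ?_
    by_contra hbot
    obtain ⟨k, c, hc⟩ := exists_mem_gradientStratum (h x hxG).continuousOn hbot
    exact hx (Set.mem_iUnion.2 ⟨⟨k, c⟩, hxG, hc⟩)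

open scoped Pointwise

/-! ### Averages over balls -/

section BallAverage

variable {E : Type*} [NormedAddCommGroup E] [InnerProductSpace ℝ E] [MeasureSpace E]

/-- The average of `F` over the ball of centre `x` and radius `s`, in a form that makes sense for
`s = 0` too. -/
noncomputable def ballAvg (F : E → ℝ) (x : E) (s : ℝ) : ℝ :=
  (volume.real (Metric.closedBall (0 : E) 1))⁻¹ *
    ∫ y in Metric.closedBall (0 : E) 1, F (x + s • y)

variable [FiniteDimensional ℝ E] [(volume : Measure E).IsAddHaarMeasure]

theorem volume_real_unitClosedBall_pos : 0 < volume.real (Metric.closedBall (0 : E) 1) :=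
  ENNReal.toReal_pos (Metric.measure_closedBall_pos _ _ one_pos).ne' measure_closedBall_lt_top.ne

theorem ballAvg_const (c : ℝ) (x : E) (s : ℝ) : ballAvg (fun _ => c) x s = c := by
  have := (volume_real_unitClosedBall_pos (E := E)).ne'
  simp only [ballAvg, setIntegral_const, smul_eq_mul]
  field_simp

theorem ballAvg_zero (F : E → ℝ) (x : E) : ballAvg F x 0 = F x := by
  simpa [ballAvg] using ballAvg_const (F x) x 0

variable [BorelSpace E]

theorem integrableOn_unitClosedBall {F : E → ℝ} (hF : Continuous F) (x : E) (s : ℝ) :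
    IntegrableOn (fun y => F (x + s • y)) (Metric.closedBall 0 1) :=
  (hF.comp (by fun_prop : Continuous fun y : E => x + s • y)).continuousOn.integrableOn_compact
    (isCompact_closedBall _ _)

theorem continuous_ballAvg {F : E → ℝ} (hF : Continuous F) :
    Continuous fun q : E × ℝ => ballAvg F q.1 q.2 :=
  continuous_const.mul (continuous_parametric_integral_of_continuous
    (f := fun (q : E × ℝ) y => F (q.1 + q.2 • y)) (by fun_prop) (isCompact_closedBall _ _))

theorem ballAvg_sub {F G : E → ℝ} (hF : Continuous F) (hG : Continuous G) (x : E) (s : ℝ) :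
    ballAvg (F - G) x s = ballAvg F x s - ballAvg G x s := by
  simp only [ballAvg, Pi.sub_apply]
  rw [integral_sub (integrableOn_unitClosedBall hF x s) (integrableOn_unitClosedBall hG x s),
    mul_sub]

theorem ballAvg_mono {F G : E → ℝ} (hF : Continuous F) (hG : Continuous G) {x : E} {s : ℝ}
    (hs : 0 ≤ s) (h : ∀ z ∈ Metric.closedBall x s, F z ≤ G z) : ballAvg F x s ≤ ballAvg G x s := by
  refine mul_le_mul_of_nonneg_left ?_ (inv_nonneg.2 volume_real_unitClosedBall_pos.le)
  refine setIntegral_mono_on (integrableOn_unitClosedBall hF x s)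
    (integrableOn_unitClosedBall hG x s) Metric.isClosed_closedBall.measurableSet fun y hy => h _ ?_
  rw [mem_closedBall_zero_iff] at hy
  rw [Metric.mem_closedBall, dist_eq_norm, add_sub_cancel_left, norm_smul, Real.norm_of_nonneg hs]
  exact mul_le_of_le_one_right hs hy

theorem abs_ballAvg_le {F : E → ℝ} (hF : Continuous F) {x : E} {s M : ℝ} (hs : 0 ≤ s)
    (h : ∀ z ∈ Metric.closedBall x s, |F z| ≤ M) : |ballAvg F x s| ≤ M := by
  rw [abs_le]
  constructor
  · rw [← ballAvg_const (-M) x s]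
    exact ballAvg_mono continuous_const hF hs fun z hz => (abs_le.1 (h z hz)).1
  · rw [← ballAvg_const M x s]
    exact ballAvg_mono hF continuous_const hs fun z hz => (abs_le.1 (h z hz)).2

/-- Linear functions have the mean value property. -/
theorem ballAvg_inner (p x₀ x : E) (s : ℝ) :
    ballAvg (fun z => inner ℝ p (z - x₀)) x s = inner ℝ p (x - x₀) := by
  classical
  have hodd : ∫ y in Metric.closedBall (0 : E) 1, inner ℝ p y = 0 := by
    rw [← integral_indicator Metric.isClosed_closedBall.measurableSet]
    have h := integral_neg_eq_self
      ((Metric.closedBall (0 : E) 1).indicator fun y => inner ℝ p y) volume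
    have h' : ∀ y, (Metric.closedBall (0 : E) 1).indicator (fun y => inner ℝ p y) (-y)
        = -(Metric.closedBall (0 : E) 1).indicator (fun y => inner ℝ p y) y := fun y => by
      by_cases hy : ‖y‖ ≤ 1 <;> simp [hy]
    simp only [h', integral_neg] at h
    linarith
  have hsplit : ∀ y : E, inner ℝ p (x + s • y - x₀) = inner ℝ p (x - x₀) + s * inner ℝ p y := by
    intro y
    rw [add_sub_right_comm, inner_add_right, inner_smul_right]
  have hi : IntegrableOn (fun y : E => s * inner ℝ p y) (Metric.closedBall 0 1) :=
    (by fun_prop : Continuous fun y : E => s * inner ℝ p y).continuousOn.integrableOn_compact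
      (isCompact_closedBall _ _)
  have hpos := (volume_real_unitClosedBall_pos (E := E)).ne'
  simp only [ballAvg, hsplit]
  have hc : IntegrableOn (fun _ : E => inner ℝ p (x - x₀)) (Metric.closedBall 0 1) :=
    continuous_const.continuousOn.integrableOn_compact (isCompact_closedBall _ _)
  rw [integral_add hc hi, integral_const_mul, hodd]
  simp only [setIntegral_const, smul_eq_mul]
  field_simp
  ring

theorem mul_ballAvg (F : E → ℝ) (x : E) {s : ℝ} (hs : 0 < s) :
    volume.real (Metric.closedBall x s) * ballAvg F x s = ∫ y in Metric.closedBall x s, F y := by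
  classical
  have h := Measure.setIntegral_comp_smul_of_pos volume (fun y => F (x + y))
    (Metric.closedBall (0 : E) 1) hs
  have hball : s • Metric.closedBall (0 : E) 1 = Metric.closedBall 0 s := by
    rw [smul_closedBall _ _ zero_le_one]; simp [abs_of_pos hs]
  have htr : ∫ y in Metric.closedBall (0 : E) s, F (x + y) = ∫ y in Metric.closedBall x s, F y := by
    rw [← integral_indicator Metric.isClosed_closedBall.measurableSet,
      ← integral_indicator Metric.isClosed_closedBall.measurableSet,
      ← integral_add_left_eq_self ((Metric.closedBall x s).indicator F) x]
    refine integral_congr_ae (Eventually.of_forall fun y => ?_)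
    simp [Set.indicator_apply, dist_eq_norm]
  rw [ballAvg, h, hball, htr, Measure.addHaar_real_closedBall' volume x hs.le]
  have := (volume_real_unitClosedBall_pos (E := E)).ne'
  have := (pow_pos hs (Module.finrank ℝ E)).ne'
  simp only [smul_eq_mul]
  field_simp

/-- The ball about `y` lies in the ball of radius `s + dist y x` about `x`; the factor is the ratio
of volumes. -/
theorem ballAvg_le_mul_ballAvg {F : E → ℝ} (hF : Continuous F) (h0 : ∀ z, 0 ≤ F z) (x y : E)
    {s : ℝ} (hs : 0 < s) :
    ballAvg F y s ≤ (1 + dist y x / s) ^ Module.finrank ℝ E * ballAvg F x (s + dist y x) := by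
  have hs' : 0 < s + dist y x := by positivity
  have hFint : ∫ z in Metric.closedBall y s, F z ≤ ∫ z in Metric.closedBall x (s + dist y x), F z :=
    setIntegral_mono_set (hF.continuousOn.integrableOn_compact (isCompact_closedBall _ _))
      (Eventually.of_forall h0)
      (Metric.closedBall_subset_closedBall' le_rfl).eventuallyLE
  rw [← mul_ballAvg F y hs, ← mul_ballAvg F x hs', Measure.addHaar_real_closedBall' volume y hs.le,
    Measure.addHaar_real_closedBall' volume x hs'.le] at hFint
  have h1 : 1 + dist y x / s = (s + dist y x) / s := by field_simp
  rw [h1, div_pow, div_mul_eq_mul_div, le_div_iff₀ (by positivity)]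
  refine le_of_mul_le_mul_left ?_ (volume_real_unitClosedBall_pos (E := E))
  linarith

/-- Each integral over a ball of radius `s` differs from that over the common larger ball by at most
`M` times the excess volume, whence the factor `2`. -/
theorem abs_ballAvg_sub_ballAvg_le {F : E → ℝ} (hF : Continuous F) (x y : E) {s M : ℝ}
    (hs : 0 < s) (hM : ∀ z ∈ Metric.closedBall x (s + dist y x), |F z| ≤ M) :
    |ballAvg F y s - ballAvg F x s| ≤ 2 * M * ((1 + dist y x / s) ^ Module.finrank ℝ E - 1) := by
  have hs' : 0 < s + dist y x := by positivity
  have hFint : ∀ z r, IntegrableOn F (Metric.closedBall z r) := fun z r =>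
    hF.continuousOn.integrableOn_compact (isCompact_closedBall _ _)
  have hdiff : ∀ z, Metric.closedBall z s ⊆ Metric.closedBall x (s + dist y x) →
      |(∫ w in Metric.closedBall x (s + dist y x), F w) - ∫ w in Metric.closedBall z s, F w| ≤
        M * (volume.real (Metric.closedBall (0 : E) 1) *
          ((s + dist y x) ^ Module.finrank ℝ E - s ^ Module.finrank ℝ E)) := fun z hz => by
    rw [← Real.norm_eq_abs,
      ← setIntegral_sdiff Metric.isClosed_closedBall.measurableSet (hFint _ _) hz]
    refine (norm_setIntegral_le_of_norm_le_const
      ((measure_mono Set.sdiff_subset).trans_lt measure_closedBall_lt_top)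
      fun w hw => hM w hw.1).trans (le_of_eq ?_)
    rw [measureReal_sdiff hz Metric.isClosed_closedBall.measurableSet
        measure_closedBall_lt_top.ne,
      Measure.addHaar_real_closedBall' volume z hs.le,
      Measure.addHaar_real_closedBall' volume x hs'.le]
    ring
  have hy := hdiff y (Metric.closedBall_subset_closedBall' le_rfl)
  have hx := hdiff x (Metric.closedBall_subset_closedBall
    (le_add_of_nonneg_right dist_nonneg))
  rw [← mul_ballAvg F y hs, Measure.addHaar_real_closedBall' volume y hs.le] at hy
  rw [← mul_ballAvg F x hs, Measure.addHaar_real_closedBall' volume x hs.le] at hx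
  have h1 : 1 + dist y x / s = (s + dist y x) / s := by field_simp
  have hsd := pow_pos hs (Module.finrank ℝ E)
  have hω := volume_real_unitClosedBall_pos (E := E)
  set ω := volume.real (Metric.closedBall (0 : E) 1)
  set σ := s ^ Module.finrank ℝ E
  set τ := (s + dist y x) ^ Module.finrank ℝ E
  have h2 : σ * ω * |ballAvg F y s - ballAvg F x s| ≤ σ * ω * (2 * M * (τ / σ - 1)) := by
    rw [← abs_of_pos (mul_pos hsd hω), ← abs_mul, abs_of_pos (mul_pos hsd hω)]
    have h3 : σ * ω * (2 * M * (τ / σ - 1)) = 2 * (M * (ω * (τ - σ))) := by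
      field_simp
    rw [h3]
    rw [abs_le] at hx hy ⊢
    constructor <;> linarith [hx.1, hx.2, hy.1, hy.2]
  rw [h1, div_pow]
  exact le_of_mul_le_mul_left h2 (mul_pos hsd hω)

/-- A convex function lies below its chord on `[0, 1]`; this makes volume ratios linear in the
displacement. -/
theorem one_add_pow_sub_one_le (d : ℕ) {t : ℝ} (h0 : 0 ≤ t) (h1 : t ≤ 1) :
    (1 + t) ^ d - 1 ≤ (2 ^ d - 1) * t := by
  induction d with
  | zero => simp
  | succ d ih =>
    have h2 : (1 : ℝ) ≤ 2 ^ d := one_le_pow₀ (by norm_num)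
    have h3 : (1 + t) ^ d * (1 + t) ≤ (1 + (2 ^ d - 1) * t) * (1 + t) :=
      mul_le_mul_of_nonneg_right (by linarith) (by linarith)
    have h4 : (2 ^ d - 1) * t * t ≤ (2 ^ d - 1) * t :=
      mul_le_of_le_one_right (mul_nonneg (by linarith) h0) h1
    rw [pow_succ, pow_succ]
    linarith

theorem abs_ballAvg_sub_ballAvg_le_of_dist_le {F : E → ℝ} (hF : Continuous F) (x y : E) {s M : ℝ}
    (hs : 0 < s) (hM : ∀ z ∈ Metric.closedBall x (s + dist y x), |F z| ≤ M) (hy : dist y x ≤ s) :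
    |ballAvg F y s - ballAvg F x s| ≤ 2 ^ (Module.finrank ℝ E + 1) * M / s * dist y x := by
  have hM0 : 0 ≤ M := (abs_nonneg _).trans (hM x (Metric.mem_closedBall_self (by positivity)))
  refine (abs_ballAvg_sub_ballAvg_le hF x y hs hM).trans ?_
  have ht : 0 ≤ dist y x / s := by positivity
  have h := one_add_pow_sub_one_le (Module.finrank ℝ E) ht ((div_le_one hs).2 hy)
  calc _ ≤ 2 * M * (2 ^ Module.finrank ℝ E * (dist y x / s)) :=
        mul_le_mul_of_nonneg_left (by linarith) (by positivity)
    _ = _ := by rw [pow_succ]; ring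

end BallAverage

/-! ### Gradients of averages over balls -/

section Gradient

variable {E : Type*} [NormedAddCommGroup E] [InnerProductSpace ℝ E]

/-- Test with `y = x + t • v` for small `t > 0`. -/
theorem norm_le_of_eventually_inner_le {v x : E} {c : ℝ} (hc : 0 ≤ c)
    (h : ∀ᶠ y in 𝓝 x, inner ℝ v (y - x) ≤ c * ‖y - x‖) : ‖v‖ ≤ c := by
  by_cases hv : v = 0
  · simpa [hv] using hc
  have htend : Tendsto (fun t : ℝ => x + t • v) (𝓝[>] 0) (𝓝 x) := by
    have : Continuous fun t : ℝ => x + t • v := by fun_prop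
    simpa using (this.tendsto 0).mono_left nhdsWithin_le_nhds
  obtain ⟨t, ht, ht0⟩ := ((htend.eventually h).and self_mem_nhdsWithin).exists
  have ht0' : (0 : ℝ) < t := ht0
  rw [add_sub_cancel_left, inner_smul_right, real_inner_self_eq_norm_sq, norm_smul,
    Real.norm_of_nonneg ht0'.le] at ht
  have hv' : 0 < t * ‖v‖ := mul_pos ht0' (norm_pos_iff.2 hv)
  refine le_of_mul_le_mul_left ?_ hv'
  linarith

variable [FiniteDimensional ℝ E]

theorem hasGradientAt_iff_eventually_inner {F : E → ℝ} {p x : E} :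
    HasGradientAt F p x ↔
      ∀ ε > 0, ∀ᶠ y in 𝓝 x, |F y - F x - inner ℝ p (y - x)| ≤ ε * ‖y - x‖ := by
  rw [hasGradientAt_iff_isLittleO, Asymptotics.isLittleO_iff]
  rfl

variable [MeasureSpace E] [(volume : Measure E).IsAddHaarMeasure]
  [BorelSpace E]

/-- The gradient is the average of the gradients of `F`. Strict differentiability and compactness of
the unit ball make the error uniform under the integral and for radii near `r`. -/
theorem exists_gradient_ballAvg_of_contDiff {F : E → ℝ} (hF : ContDiff ℝ 1 F) (x : E) (r : ℝ) :
    ∃ p : E, ∀ ε > 0, ∀ᶠ q : E × ℝ in 𝓝 (x, r),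
      |ballAvg F q.1 q.2 - ballAvg F x q.2 - inner ℝ p (q.1 - x)| ≤ ε * ‖q.1 - x‖ := by
  have hD : Continuous (fderiv ℝ F) := hF.continuous_fderiv one_ne_zero
  have hDy : Continuous fun y : E => fderiv ℝ F (x + r • y) := hD.comp (by fun_prop)
  have hDint : IntegrableOn (fun y => fderiv ℝ F (x + r • y)) (Metric.closedBall (0 : E) 1) :=
    hDy.continuousOn.integrableOn_compact (isCompact_closedBall _ _)
  have hω := volume_real_unitClosedBall_pos (E := E)
  set ω := volume.real (Metric.closedBall (0 : E) 1) with hωdef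
  let L : E →L[ℝ] ℝ := ω⁻¹ • ∫ y in Metric.closedBall (0 : E) 1, fderiv ℝ F (x + r • y)
  refine ⟨(InnerProductSpace.toDual ℝ E).symm L, fun ε hε => ?_⟩
  have hev : ∀ᶠ q : E × ℝ in 𝓝 (x, r), ∀ y ∈ Metric.closedBall (0 : E) 1,
      ‖F (q.1 + q.2 • y) - F (x + q.2 • y) - fderiv ℝ F (x + r • y) (q.1 - x)‖
        ≤ ε * ‖q.1 - x‖ := by
    refine (isCompact_closedBall _ _).eventually_forall_of_forall_eventually fun y _ => ?_
    have h1 := (hF.contDiffAt (x := x + r • y)).hasStrictFDerivAt one_ne_zero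
    have h2 := h1.isLittleO.def (half_pos hε)
    have ht : Tendsto (fun z : (E × ℝ) × E => (z.1.1 + z.1.2 • z.2, x + z.1.2 • z.2))
        (𝓝 ((x, r), y)) (𝓝 (x + r • y, x + r • y)) :=
      (by fun_prop : Continuous fun z : (E × ℝ) × E =>
        (z.1.1 + z.1.2 • z.2, x + z.1.2 • z.2)).tendsto ((x, r), y)
    have h3 : ∀ᶠ z : (E × ℝ) × E in 𝓝 ((x, r), y),
        dist (fderiv ℝ F (x + r • z.2)) (fderiv ℝ F (x + r • y)) < ε / 2 :=
      Metric.tendsto_nhds.1 ((hDy.comp continuous_snd).tendsto ((x, r), y)) _ (half_pos hε)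
    filter_upwards [ht.eventually h2, h3] with z hz2 hz3
    rw [dist_comm, dist_eq_norm] at hz3
    simp only [add_sub_add_right_eq_sub] at hz2
    have h4 := (fderiv ℝ F (x + r • y) - fderiv ℝ F (x + r • z.2)).le_of_opNorm_le hz3.le
      (z.1.1 - x)
    rw [sub_apply] at h4
    have h5 := norm_add_le_of_le hz2 h4
    rw [sub_add_sub_cancel] at h5
    linarith
  filter_upwards [hev] with q hq
  have hi := fun z => integrableOn_unitClosedBall hF.continuous z q.2
  have hLi : IntegrableOn (fun y => fderiv ℝ F (x + r • y) (q.1 - x))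
      (Metric.closedBall (0 : E) 1) :=
    (hDy.clm_apply continuous_const).continuousOn.integrableOn_compact (isCompact_closedBall _ _)
  have hbound := norm_setIntegral_le_of_norm_le_const
    (measure_closedBall_lt_top (μ := (volume : Measure E)) (x := 0) (r := 1)) hq
  have hsub : IntegrableOn (fun y => F (q.1 + q.2 • y) - F (x + q.2 • y))
      (Metric.closedBall (0 : E) 1) := (hi q.1).sub (hi x)
  rw [integral_sub hsub hLi, integral_sub (hi q.1) (hi x)] at hbound
  rw [InnerProductSpace.toDual_symm_apply]
  have hL : L (q.1 - x) = ω⁻¹ * ∫ y in Metric.closedBall (0 : E) 1,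
      fderiv ℝ F (x + r • y) (q.1 - x) := by
    simp only [L, smul_apply, smul_eq_mul]
    rw [ContinuousLinearMap.integral_apply hDint]
  rw [hL, ballAvg, ballAvg, ← hωdef, ← mul_sub, ← mul_sub, abs_mul, abs_of_pos (inv_pos.2 hω),
    inv_mul_le_iff₀ hω, mul_comm]
  exact hbound

/-- The averages of a continuous function over balls of radius near `r > 0` are differentiable in
the centre, uniformly in the radius. -/
theorem exists_gradient_ballAvg {F : E → ℝ} (hF : Continuous F) (x : E) {r : ℝ} (hr : 0 < r) :
    ∃ p : E, ∀ ε > 0, ∀ᶠ q : E × ℝ in 𝓝 (x, r),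
      |ballAvg F q.1 q.2 - ballAvg F x q.2 - inner ℝ p (q.1 - x)| ≤ ε * ‖q.1 - x‖ := by
  have happrox : ∀ ε > 0, ∃ p : E, ∀ᶠ q : E × ℝ in 𝓝 (x, r),
      |ballAvg F q.1 q.2 - ballAvg F x q.2 - inner ℝ p (q.1 - x)| ≤ ε * ‖q.1 - x‖ := by
    intro ε hε
    set C : ℝ := 2 ^ (Module.finrank ℝ E + 1)
    have hC : 0 < C := by positivity
    have hη : 0 < ε * r / (4 * C) := by positivity
    -- The averages of `F - G` over radii above `r / 2` then change by at most `C * (ε * r / (4 *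
    -- C)) / (r / 2) = ε / 2` per unit displacement of the centre.
    obtain ⟨G, hG, hGF, -⟩ := hF.exists_contDiff_approx 1 (ε := fun _ => ε * r / (4 * C))
      continuous_const fun _ => hη
    obtain ⟨p, hp⟩ := exists_gradient_ballAvg_of_contDiff hG x r
    refine ⟨p, ?_⟩
    have hs : ∀ᶠ q : E × ℝ in 𝓝 (x, r), r / 2 < q.2 :=
      (continuous_snd.tendsto (x, r)).eventually (lt_mem_nhds (half_lt_self hr))
    have hd : ∀ᶠ q : E × ℝ in 𝓝 (x, r), dist q.1 x < r / 2 :=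
      (continuous_fst.tendsto (x, r)).eventually (Metric.ball_mem_nhds x (half_pos hr))
    filter_upwards [hp (ε / 2) (half_pos hε), hs, hd] with q hq hqs hqd
    have hq0 : 0 < q.2 := (half_pos hr).trans hqs
    have hdiff := abs_ballAvg_sub_ballAvg_le_of_dist_le (hF.sub hG.continuous) x q.1
      (M := ε * r / (4 * C)) hq0 (fun z _ => by
        have := (hGF z).le
        rwa [dist_comm, Real.dist_eq] at this) (hqd.trans hqs).le
    have hcoef : C * (ε * r / (4 * C)) / q.2 ≤ ε / 2 := by
      rw [div_le_iff₀ hq0]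
      calc C * (ε * r / (4 * C)) = ε / 2 * (r / 2) := by field_simp; ring
        _ ≤ ε / 2 * q.2 := by gcongr
    have hdiff' := hdiff.trans (mul_le_mul_of_nonneg_right hcoef dist_nonneg)
    rw [ballAvg_sub hF hG.continuous, ballAvg_sub hF hG.continuous, dist_eq_norm] at hdiff'
    rw [abs_le] at hq hdiff' ⊢
    constructor <;> linarith [hq.1, hq.2, hdiff'.1, hdiff'.2]
  choose p hp using fun k : ℕ => happrox (1 / ((k : ℝ) + 1)) (by positivity)
  -- Both are approximate gradients of one function, the average of radius `r`, so they form a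
  -- Cauchy sequence.
  have hclose : ∀ k l, dist (p k) (p l) ≤ 1 / ((k : ℝ) + 1) + 1 / ((l : ℝ) + 1) := fun k l => by
    have hslice : Tendsto (fun y => (y, r)) (𝓝 x) (𝓝 (x, r)) :=
      (by fun_prop : Continuous fun y : E => (y, r)).tendsto x
    have h : ∀ᶠ y in 𝓝 x, inner ℝ (p k - p l) (y - x)
        ≤ (1 / ((k : ℝ) + 1) + 1 / ((l : ℝ) + 1)) * ‖y - x‖ := by
      filter_upwards [hslice.eventually (hp k), hslice.eventually (hp l)] with y h1 h2
      rw [abs_le] at h1 h2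
      rw [inner_sub_left]
      linarith [h1.1, h2.2]
    rw [dist_eq_norm]
    exact norm_le_of_eventually_inner_le (by positivity) h
  have hlim : Tendsto (fun k : ℕ => 1 / ((k : ℝ) + 1)) atTop (𝓝 0) :=
    tendsto_one_div_add_atTop_nhds_zero_nat
  have hcauchy : CauchySeq p := by
    refine cauchySeq_of_le_tendsto_0 (fun N : ℕ => 1 / ((N : ℝ) + 1) + 1 / ((N : ℝ) + 1))
      (fun k l N hk hl => (hclose k l).trans ?_) (by simpa using hlim.add hlim)
    gcongr
  obtain ⟨p₀, hp₀⟩ := cauchySeq_tendsto_of_complete hcauchy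
  refine ⟨p₀, fun ε hε => ?_⟩
  obtain ⟨k, hk1, hk2⟩ := ((hlim.eventually (gt_mem_nhds (half_pos hε))).and
    (Metric.tendsto_nhds.1 hp₀ _ (half_pos hε))).exists
  filter_upwards [hp k] with q hq
  have h1 : |inner ℝ (p k - p₀) (q.1 - x)| ≤ ε / 2 * ‖q.1 - x‖ :=
    (abs_real_inner_le_norm _ _).trans
      (mul_le_mul_of_nonneg_right (by rw [← dist_eq_norm]; exact hk2.le) (norm_nonneg _))
  have h2 := hq.trans (mul_le_mul_of_nonneg_right hk1.le (norm_nonneg _))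
  rw [inner_sub_left] at h1
  rw [abs_le] at h1 h2 ⊢
  constructor <;> linarith [h1.1, h1.2, h2.1, h2.2]

theorem eventually_abs_ballAvg_sub_le {F : E → ℝ} (hF : Continuous F) (x : E) {r : ℝ}
    (hr : 0 < r) {ε : ℝ} (hε : 0 < ε) :
    ∀ᶠ q : E × ℝ in 𝓝 (x, r), |ballAvg F q.1 q.2 - ballAvg F x q.2 -
      inner ℝ (gradient (fun z => ballAvg F z r) x) (q.1 - x)| ≤ ε * ‖q.1 - x‖ := by
  obtain ⟨p, hp⟩ := exists_gradient_ballAvg hF x hr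
  have hslice : Tendsto (fun y => (y, r)) (𝓝 x) (𝓝 (x, r)) :=
    (by fun_prop : Continuous fun y : E => (y, r)).tendsto x
  have h : HasGradientAt (fun z => ballAvg F z r) p x :=
    hasGradientAt_iff_eventually_inner.2 fun ε hε => hslice.eventually (hp ε hε)
  rw [h.gradient]
  exact hp ε hε

theorem hasGradientAt_ballAvg {F : E → ℝ} (hF : Continuous F) {x : E}
    (hx : DifferentiableAt ℝ F x) {r : ℝ} (hr : 0 ≤ r) :
    HasGradientAt (fun z => ballAvg F z r) (gradient (fun z => ballAvg F z r) x) x := by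
  rcases hr.eq_or_lt with rfl | hr
  · simp only [ballAvg_zero]
    exact hx.hasGradientAt
  · have hslice : Tendsto (fun y => (y, r)) (𝓝 x) (𝓝 (x, r)) :=
      (by fun_prop : Continuous fun y : E => (y, r)).tendsto x
    exact hasGradientAt_iff_eventually_inner.2 fun ε hε =>
      hslice.eventually (eventually_abs_ballAvg_sub_le hF x hr hε)

end Gradient

/-! ### Active radii of the maximal function -/

section ActiveRadii

variable {E : Type*} [NormedAddCommGroup E] [InnerProductSpace ℝ E] [MeasureSpace E]

/-- The radii at which the supremum `g x` of the averages of `F` is attained. The radius `∞` is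
active at the minima of `g`. -/
def activeRadii (F g : E → ℝ) (x : E) : Set ℝ≥0∞ :=
  {r | (r ≠ ∞ ∧ ballAvg F x r.toReal = g x) ∨ (r = ∞ ∧ ∀ z, g x ≤ g z)}

open Classical in
/-- The gradient in the centre of the average of `F` over a ball of given radius, understood as `0`
for the radius `∞`. -/
noncomputable def ballGradient [FiniteDimensional ℝ E] (F : E → ℝ) (x : E) (r : ℝ≥0∞) : E :=
  if r = ∞ then 0 else gradient (fun z => ballAvg F z r.toReal) x

variable [FiniteDimensional ℝ E] [(volume : Measure E).IsAddHaarMeasure] [BorelSpace E]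
  {F g : E → ℝ}

theorem ballAvg_le_of_isLUB (hF : Continuous F)
    (hg : ∀ x, IsLUB (ballAvg F x '' Set.Ioi 0) (g x)) (x : E) {s : ℝ} (hs : 0 ≤ s) :
    ballAvg F x s ≤ g x := by
  have hc : Continuous fun t : ℝ => ballAvg F x t :=
    (continuous_ballAvg hF).comp (by fun_prop : Continuous fun t : ℝ => (x, t))
  have h : Set.Ici (0 : ℝ) ⊆ {t | ballAvg F x t ≤ g x} := by
    rw [← closure_Ioi]
    exact closure_minimal (fun t ht => (hg x).1 ⟨t, ht, rfl⟩) (isClosed_le hc continuous_const)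
  exact h hs

theorem ballAvg_le_mul_of_isLUB (hF : Continuous F) (h0 : ∀ z, 0 ≤ F z)
    (hg : ∀ x, IsLUB (ballAvg F x '' Set.Ioi 0) (g x)) (x y : E) {s : ℝ} (hs : 0 < s) :
    ballAvg F y s ≤ (1 + dist y x / s) ^ Module.finrank ℝ E * g x :=
  (ballAvg_le_mul_ballAvg hF h0 x y hs).trans (mul_le_mul_of_nonneg_left
    (ballAvg_le_of_isLUB hF hg x (by positivity)) (by positivity))

theorem nonneg_of_isLUB (hF : Continuous F) (h0 : ∀ z, 0 ≤ F z)
    (hg : ∀ x, IsLUB (ballAvg F x '' Set.Ioi 0) (g x)) (x : E) : 0 ≤ g x := by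
  have := ballAvg_le_of_isLUB hF hg x le_rfl
  rw [ballAvg_zero] at this
  exact (h0 x).trans this

/-- If `g x` is a limit of averages over balls whose radii tend to infinity, it is the minimum
of `g`. -/
theorem le_of_tendsto_ballAvg_atTop (hF : Continuous F) (h0 : ∀ z, 0 ≤ F z)
    (hg : ∀ x, IsLUB (ballAvg F x '' Set.Ioi 0) (g x)) {ι : Type*} {l : Filter ι} [l.NeBot]
    {y : ι → E} {s : ι → ℝ} {x : E} (hy : Tendsto y l (𝓝 x)) (hs : Tendsto s l atTop)
    (h : Tendsto (fun i => ballAvg F (y i) (s i)) l (𝓝 (g x))) (z : E) : g x ≤ g z := by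
  have hlim : Tendsto (fun i => (1 + dist (y i) z / s i) ^ Module.finrank ℝ E * g z) l
      (𝓝 ((1 + 0) ^ Module.finrank ℝ E * g z)) :=
    (((hy.dist tendsto_const_nhds).div_atTop hs).const_add 1 |>.pow _).mul_const _
  rw [add_zero, one_pow, one_mul] at hlim
  refine le_of_tendsto_of_tendsto h hlim ?_
  filter_upwards [hs.eventually_gt_atTop 0] with i hi
  exact ballAvg_le_mul_of_isLUB hF h0 hg z (y i) hi

theorem tendsto_toReal_atTop_of_tendsto_top {ι : Type*} {l : Filter ι} {r : ι → ℝ≥0∞}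
    (hr : Tendsto r l (𝓝 ∞)) (hne : ∀ᶠ i in l, r i ≠ ∞) :
    Tendsto (fun i => (r i).toReal) l atTop := by
  refine tendsto_atTop.2 fun b => ?_
  filter_upwards [hr.eventually (lt_mem_nhds ENNReal.ofReal_lt_top), hne] with i hi hi'
  exact (ENNReal.ofReal_le_iff_le_toReal hi').1 (le_of_lt hi)

/-- Finite active radii tending to `∞` force `g x` to be the minimum, which is why `∞` is declared
active only at minima. -/
theorem isClosed_activeRadii (hF : Continuous F) (h0 : ∀ z, 0 ≤ F z)
    (hg : ∀ x, IsLUB (ballAvg F x '' Set.Ioi 0) (g x)) (hgc : Continuous g) :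
    IsClosed {q : E × ℝ≥0∞ | q.2 ∈ activeRadii F g q.1} := by
  refine isClosed_iff_ultrafilter.2 fun ⟨x, r⟩ U hU hmem => ?_
  have hy : Tendsto Prod.fst (U : Filter (E × ℝ≥0∞)) (𝓝 x) :=
    (continuous_fst.tendsto (x, r)).mono_left hU
  have hr : Tendsto Prod.snd (U : Filter (E × ℝ≥0∞)) (𝓝 r) :=
    (continuous_snd.tendsto (x, r)).mono_left hU
  have hgy : Tendsto (fun q : E × ℝ≥0∞ => g q.1) U (𝓝 (g x)) := (hgc.tendsto x).comp hy
  rcases Ultrafilter.eventually_or.1 (show ∀ᶠ q in (U : Filter (E × ℝ≥0∞)), _ ∨ _ from hmem)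
    with h | h
  · have hA : Tendsto (fun q : E × ℝ≥0∞ => ballAvg F q.1 q.2.toReal) U (𝓝 (g x)) :=
      hgy.congr' (h.mono fun q hq => hq.2.symm)
    by_cases hrt : r = ∞
    · subst hrt
      exact Or.inr ⟨rfl, le_of_tendsto_ballAvg_atTop hF h0 hg hy
        (tendsto_toReal_atTop_of_tendsto_top hr (h.mono fun q hq => hq.1)) hA⟩
    · have hA' : Tendsto (fun q : E × ℝ≥0∞ => ballAvg F q.1 q.2.toReal) U
          (𝓝 (ballAvg F x r.toReal)) :=
        ((continuous_ballAvg hF).tendsto (x, r.toReal)).comp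
          (hy.prodMk_nhds ((ENNReal.tendsto_toReal hrt).comp hr))
      exact Or.inl ⟨hrt, tendsto_nhds_unique hA' hA⟩
  · have hrt : r = ∞ := tendsto_nhds_unique hr
      (tendsto_const_nhds.congr' (h.mono fun q hq => hq.1.symm))
    exact Or.inr ⟨hrt, fun z => le_of_tendsto hgy (h.mono fun q hq => hq.2 z)⟩

/-- A maximizing sequence of radii clusters in the compact `[0, ∞]`; a limit `0` is harmless because
the average extends continuously by `F x`. -/
theorem activeRadii_nonempty (hF : Continuous F) (h0 : ∀ z, 0 ≤ F z)
    (hg : ∀ x, IsLUB (ballAvg F x '' Set.Ioi 0) (g x)) (x : E) :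
    (activeRadii F g x).Nonempty := by
  obtain ⟨u, -, -, hu, hmem⟩ := (hg x).exists_seq_monotone_tendsto
    (Set.nonempty_Ioi.image (ballAvg F x))
  choose s hs hsu using hmem
  have hle : (hyperfilter ℕ : Filter ℕ) ≤ atTop := by
    rw [← Nat.cofinite_eq_atTop]; exact hyperfilter_le_cofinite
  have hA : Tendsto (fun k => ballAvg F x (s k)) (hyperfilter ℕ) (𝓝 (g x)) := by
    simpa only [hsu] using hu.mono_left hle
  obtain ⟨r, -, hr⟩ := isCompact_univ.ultrafilter_le_nhds
    ((hyperfilter ℕ).map fun k => ENNReal.ofReal (s k)) (by simp)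
  have hr' : Tendsto (fun k => ENNReal.ofReal (s k)) (hyperfilter ℕ) (𝓝 r) := hr
  have hreal : ∀ k, (ENNReal.ofReal (s k)).toReal = s k := fun k =>
    ENNReal.toReal_ofReal (le_of_lt (hs k))
  by_cases hrt : r = ∞
  · subst hrt
    have hs' := tendsto_toReal_atTop_of_tendsto_top hr' (by simp)
    simp only [hreal] at hs'
    exact ⟨∞, Or.inr ⟨rfl, le_of_tendsto_ballAvg_atTop hF h0 hg tendsto_const_nhds hs' hA⟩⟩
  · have hs' := (ENNReal.tendsto_toReal hrt).comp hr'
    simp only [Function.comp_def, hreal] at hs'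
    exact ⟨r, Or.inl ⟨hrt, tendsto_nhds_unique (((continuous_ballAvg hF).tendsto
      (x, r.toReal)).comp (tendsto_const_nhds.prodMk_nhds hs')) hA⟩⟩

/-- With the affine part of `F` at `x` removed, the remainder `e` is small relative to `‖z - x‖`.
For `dist y x ≤ s` the centre-displacement bound for averages of `e` applies; for smaller `s` the
size of `e` suffices. Comparing with `g x` instead of `ballAvg F x s` leaves only an upper bound. -/
theorem eventually_ballAvg_sub_le_of_differentiableAt (hF : Continuous F)
    (hg : ∀ x, IsLUB (ballAvg F x '' Set.Ioi 0) (g x)) {x : E} (hx : DifferentiableAt ℝ F x)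
    {ε : ℝ} (hε : 0 < ε) :
    ∀ᶠ q : E × ℝ in 𝓝 (x, 0), 0 ≤ q.2 →
      ballAvg F q.1 q.2 - g x ≤ inner ℝ (gradient F x) (q.1 - x) + ε * ‖q.1 - x‖ := by
  set C : ℝ := 2 ^ (Module.finrank ℝ E + 1)
  have hC : 1 ≤ C := one_le_pow₀ (by norm_num)
  have hη : 0 < ε / (2 * C) := by positivity
  set p := gradient F x
  obtain ⟨δ, hδ, hball⟩ := Metric.eventually_nhds_iff.1
    (hasGradientAt_iff_eventually_inner.1 hx.hasGradientAt _ hη)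
  let e : E → ℝ := (F - fun _ => F x) - fun y => inner ℝ p (y - x)
  have hec : Continuous e := by fun_prop
  have heavg : ∀ y s, ballAvg e y s = ballAvg F y s - F x - inner ℝ p (y - x) := fun y s => by
    rw [ballAvg_sub (by fun_prop) (by fun_prop), ballAvg_sub hF continuous_const, ballAvg_const,
      ballAvg_inner]
  have h1 : ∀ᶠ q : E × ℝ in 𝓝 (x, 0), dist q.1 x < δ / 2 :=
    (continuous_fst.tendsto (x, (0 : ℝ))).eventually (Metric.ball_mem_nhds x (half_pos hδ))
  have h2 : ∀ᶠ q : E × ℝ in 𝓝 (x, 0), q.2 < δ / 2 :=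
    (continuous_snd.tendsto (x, (0 : ℝ))).eventually (gt_mem_nhds (half_pos hδ))
  filter_upwards [h1, h2] with ⟨y, s⟩ hy hs hs0
  dsimp only at hy hs hs0 ⊢
  have he : ∀ z ∈ Metric.closedBall x (s + dist y x), |e z| ≤ ε / (2 * C) * (s + dist y x) := by
    intro z hz
    rw [Metric.mem_closedBall] at hz
    refine (hball (by linarith)).trans ?_
    rw [← dist_eq_norm]
    gcongr
  rcases le_or_gt (dist y x) s with hys | hys
  · rcases hs0.eq_or_lt with rfl | hs0
    · have : y = x := dist_le_zero.1 hys
      subst this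
      simpa using ballAvg_le_of_isLUB hF hg y le_rfl
    have h3 := abs_ballAvg_sub_ballAvg_le_of_dist_le hec x y hs0 he hys
    have hcoef : C * (ε / (2 * C) * (s + dist y x)) / s ≤ ε := by
      rw [div_le_iff₀ hs0]
      have : C * (ε / (2 * C) * (s + dist y x)) = ε / 2 * (s + dist y x) := by field_simp
      rw [this]
      nlinarith
    have h4 := h3.trans (mul_le_mul_of_nonneg_right hcoef dist_nonneg)
    rw [heavg, heavg, sub_self, inner_zero_right, dist_eq_norm] at h4
    have := ballAvg_le_of_isLUB hF hg x hs0.le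
    linarith [(abs_le.1 h4).2]
  · have h3 := abs_ballAvg_le hec hs0 fun z hz => he z
      (Metric.closedBall_subset_closedBall' le_rfl hz)
    rw [heavg] at h3
    have hFx := ballAvg_le_of_isLUB hF hg x le_rfl
    rw [ballAvg_zero] at hFx
    have hcoef : ε / (2 * C) * (s + dist y x) ≤ ε * ‖y - x‖ := by
      rw [← dist_eq_norm]
      calc ε / (2 * C) * (s + dist y x) ≤ ε / 2 * (dist y x + dist y x) := by
            gcongr; linarith
        _ = _ := by ring
    linarith [(abs_le.1 h3).2]

/-- One-sided differentiability at `x` of the averages of `F`, uniformly in radii near `r`. -/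
theorem eventually_ballAvg_sub_le (hF : Continuous F) (h0 : ∀ z, 0 ≤ F z)
    (hg : ∀ x, IsLUB (ballAvg F x '' Set.Ioi 0) (g x)) {x : E} (hx : DifferentiableAt ℝ F x)
    (r : ℝ≥0∞) {ε : ℝ} (hε : 0 < ε) :
    ∀ᶠ q : E × ℝ≥0∞ in 𝓝 (x, r), q.2 ≠ ∞ →
      ballAvg F q.1 q.2.toReal - g x ≤
        inner ℝ (ballGradient F x r) (q.1 - x) + ε * ‖q.1 - x‖ := by
  by_cases hrt : r = ∞
  · subst hrt
    set C : ℝ := 2 ^ Module.finrank ℝ E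
    have hgx := nonneg_of_isLUB hF h0 hg x
    have h1 : ∀ᶠ q : E × ℝ≥0∞ in 𝓝 (x, ∞), dist q.1 x < 1 :=
      (continuous_fst.tendsto (x, ∞)).eventually (Metric.ball_mem_nhds x one_pos)
    -- Radii above `1` exceed `dist y x`, and those above `C * g x / ε` make the slope `C * g x / t`
    -- at most `ε`.
    have h2 : ∀ᶠ q : E × ℝ≥0∞ in 𝓝 (x, ∞), ENNReal.ofReal (max 1 (C * g x / ε)) < q.2 :=
      (continuous_snd.tendsto (x, ∞)).eventually (lt_mem_nhds ENNReal.ofReal_lt_top)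
    filter_upwards [h1, h2] with ⟨y, s⟩ hy hs hst
    dsimp only at hy hs hst ⊢
    have hs' := (ENNReal.ofReal_le_iff_le_toReal hst).1 hs.le
    set t := s.toReal
    have ht1 : 1 ≤ t := (le_max_left _ _).trans hs'
    have ht2 : C * g x / ε ≤ t := (le_max_right _ _).trans hs'
    have ht0 : 0 < t := by linarith
    have h3 := ballAvg_le_mul_of_isLUB hF h0 hg x y ht0
    have h4 := one_add_pow_sub_one_le (Module.finrank ℝ E) (t := dist y x / t) (by positivity)
      ((div_le_one ht0).2 (by linarith))
    have h5 : ((1 + dist y x / t) ^ Module.finrank ℝ E - 1) * g x ≤ C * (dist y x / t) * g x := by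
      refine mul_le_mul_of_nonneg_right (h4.trans ?_) hgx
      have : 0 ≤ dist y x / t := by positivity
      linarith
    have h6 : C * (dist y x / t) * g x ≤ ε * dist y x := by
      rw [div_le_iff₀ hε] at ht2
      calc C * (dist y x / t) * g x = C * g x / t * dist y x := by ring
        _ ≤ ε * dist y x := by
          gcongr
          rw [div_le_iff₀ ht0]; linarith
    simp only [ballGradient, if_true, inner_zero_left, zero_add]
    rw [← dist_eq_norm]
    linarith
  · have ht : Tendsto (fun q : E × ℝ≥0∞ => (q.1, q.2.toReal)) (𝓝 (x, r)) (𝓝 (x, r.toReal)) :=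
      (continuous_fst.tendsto _).prodMk_nhds
        ((ENNReal.tendsto_toReal hrt).comp (continuous_snd.tendsto (x, r)))
    simp only [ballGradient, if_neg hrt]
    rcases (ENNReal.toReal_nonneg (a := r)).eq_or_lt with hr0 | hr0
    · rw [← hr0] at ht ⊢
      simp only [ballAvg_zero]
      filter_upwards [ht.eventually (eventually_ballAvg_sub_le_of_differentiableAt hF hg hx hε)]
        with q hq _
      exact hq ENNReal.toReal_nonneg
    · filter_upwards [ht.eventually (eventually_abs_ballAvg_sub_le hF x hr0 hε)] with q hq _
      have := ballAvg_le_of_isLUB hF hg x (ENNReal.toReal_nonneg (a := q.2))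
      linarith [(abs_le.1 hq).2]

theorem hasActiveGradients_ballGradient (hF : Continuous F) (h0 : ∀ z, 0 ≤ F z)
    (hg : ∀ x, IsLUB (ballAvg F x '' Set.Ioi 0) (g x)) {x : E} (hx : DifferentiableAt ℝ F x) :
    HasActiveGradients g (activeRadii F g) (ballGradient F) x where
  lower r hr ε hε := by
    rcases hr with ⟨hrt, hr⟩ | ⟨rfl, hr⟩
    · simp only [ballGradient, if_neg hrt]
      filter_upwards [hasGradientAt_iff_eventually_inner.1
        (hasGradientAt_ballAvg hF hx (ENNReal.toReal_nonneg (a := r))) ε hε] with y hy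
      have := ballAvg_le_of_isLUB hF hg y (ENNReal.toReal_nonneg (a := r))
      linarith [(abs_le.1 hy).1]
    · refine Eventually.of_forall fun y => ?_
      have : 0 ≤ ε * ‖y - x‖ := by positivity
      simp only [ballGradient, if_true, inner_zero_left]
      linarith [hr y]
  upper r _ ε hε := by
    by_cases hrt : r = ∞
    · subst hrt
      filter_upwards [eventually_ballAvg_sub_le hF h0 hg hx ∞ hε] with q hq hqR
      rcases hqR with ⟨hqt, hqR⟩ | ⟨-, hqR⟩
      · rw [← hqR]; exact hq hqt
      -- Here `q.1` minimizes `g`, so the increment is nonpositive.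
      · have : 0 ≤ ε * ‖q.1 - x‖ := by positivity
        simp only [ballGradient, if_true, inner_zero_left]
        linarith [hqR x]
    · filter_upwards [eventually_ballAvg_sub_le hF h0 hg hx r hε,
        (continuous_snd.tendsto (x, r)).eventually (isOpen_ne.mem_nhds hrt)] with q hq hqt hqR
      rcases hqR with ⟨-, hqR⟩ | ⟨hqt', -⟩
      · rw [← hqR]; exact hq hqt
      · exact (hqt hqt').elim
  continuousOn r _ := by
    refine Metric.tendsto_nhds.2 fun ε hε => eventually_nhdsWithin_iff.2 ?_
    have hε' : 0 < ε / 4 := by positivity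
    have hev := eventually_ballAvg_sub_le hF h0 hg hx r hε'
    -- Splitting the neighbourhood fixes an active `s` near `r` while `y` varies. The upper estimate
    -- at `r`, against the true gradient at `s`, bounds the difference of gradients.
    rw [nhds_prod_eq] at hev
    obtain ⟨pa, ha, pb, hb, hab⟩ := eventually_prod_iff.1 hev
    have htop : ∀ᶠ s in 𝓝 r, s = ∞ → r = ∞ := by
      by_cases hrt : r = ∞
      · exact Eventually.of_forall fun _ _ => hrt
      · filter_upwards [isOpen_ne.mem_nhds hrt] with s hs hs' using (hs hs').elim
    filter_upwards [hb, htop] with s hs hst hsR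
    rcases hsR with ⟨hst', hsR⟩ | ⟨hst', -⟩
    · have hgrad : ∀ᶠ y in 𝓝 x, inner ℝ (ballGradient F x s - ballGradient F x r) (y - x)
          ≤ ε / 2 * ‖y - x‖ := by
        filter_upwards [ha, hasGradientAt_iff_eventually_inner.1
          (hasGradientAt_ballAvg hF hx (ENNReal.toReal_nonneg (a := s))) _ hε'] with y hy hy'
        have h1 := hab hy hs hst'
        rw [inner_sub_left, show ballGradient F x s = _ from if_neg hst']
        linarith [(abs_le.1 hy').1]
      rw [dist_eq_norm]
      linarith [norm_le_of_eventually_inner_le (by positivity) hgrad]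
    · rw [hst', hst hst', dist_self]
      exact hε

/-- The supremum of the averages over balls of a nonnegative continuous function is continuous
where it is finite. -/
theorem continuous_of_isLUB_ballAvg (hF : Continuous F) (h0 : ∀ z, 0 ≤ F z)
    (hg : ∀ x, IsLUB (ballAvg F x '' Set.Ioi 0) (g x)) : Continuous g := by
  refine continuous_iff_continuousAt.2 fun x => tendsto_order.2 ⟨fun c hc => ?_, fun c hc => ?_⟩
  · obtain ⟨_, ⟨s, hs, rfl⟩, hcs⟩ := (lt_isLUB_iff (hg x)).1 hc
    have hA : Continuous fun y => ballAvg F y s :=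
      (continuous_ballAvg hF).comp (by fun_prop : Continuous fun y : E => (y, s))
    filter_upwards [(hA.tendsto x).eventually (lt_mem_nhds hcs)] with y hy
    exact hy.trans_le (ballAvg_le_of_isLUB hF hg y (le_of_lt hs))
  · obtain ⟨b, hgb, hbc⟩ := exists_between hc
    have hFx := ballAvg_le_of_isLUB hF hg x le_rfl
    rw [ballAvg_zero] at hFx
    -- Upper semicontinuity: below radius `δ / 2` the averages stay in the region where `F < b`;
    -- above it, the volume ratio is uniformly close to `1`.
    obtain ⟨δ, hδ, hball⟩ := Metric.eventually_nhds_iff.1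
      ((hF.tendsto x).eventually (gt_mem_nhds (hFx.trans_lt hgb)))
    have hlim : Tendsto (fun y => (1 + dist y x / (δ / 2)) ^ Module.finrank ℝ E * g x) (𝓝 x)
        (𝓝 (g x)) := by
      have hcont : Continuous fun y => (1 + dist y x / (δ / 2)) ^ Module.finrank ℝ E * g x := by
        fun_prop
      simpa using hcont.tendsto x
    filter_upwards [hlim.eventually (gt_mem_nhds hgb), Metric.ball_mem_nhds x (half_pos hδ)]
      with y hy hyx
    rw [Metric.mem_ball] at hyx
    refine lt_of_le_of_lt ((isLUB_le_iff (hg y)).2 ?_) hbc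
    rintro _ ⟨s, hs, rfl⟩
    have hs' : 0 < s := hs
    rcases lt_or_ge s (δ / 2) with hsδ | hsδ
    · rw [← ballAvg_const b y s]
      refine ballAvg_mono hF continuous_const hs'.le fun z hz => (hball ?_).le
      rw [Metric.mem_closedBall] at hz
      linarith [dist_triangle z y x]
    · refine (ballAvg_le_mul_of_isLUB hF h0 hg x y hs').trans (le_trans ?_ hy.le)
      have := nonneg_of_isLUB hF h0 hg x
      gcongr

end ActiveRadii

/-- The supremum `g` of the averages over balls of a nonnegative continuous function that is
differentiable off a `σ`-tangential set is itself differentiable off a `σ`-tangential set. -/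
theorem exists_isSigmaTangential_of_isLUB_ballAvg {n : ℕ} (hn : 1 ≤ n)
    {F g : EuclideanSpace ℝ (Fin n) → ℝ} (hF : Continuous F) (h0 : ∀ z, 0 ≤ F z)
    (hg : ∀ x, IsLUB (ballAvg F x '' Set.Ioi 0) (g x))
    {S : Set (EuclideanSpace ℝ (Fin n))} (hS : IsSigmaTangential S)
    (hdiff : ∀ x ∉ S, DifferentiableAt ℝ F x) :
    ∃ S' : Set (EuclideanSpace ℝ (Fin n)), IsSigmaTangential S' ∧
      ∀ x ∉ S', DifferentiableAt ℝ g x := by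
  obtain ⟨S', hS', hd⟩ := exists_isSigmaTangential_of_hasActiveGradients hn
    (isClosed_activeRadii hF h0 hg (continuous_of_isLUB_ballAvg hF h0 hg))
    (activeRadii_nonempty hF h0 hg) (G := Sᶜ)
    fun x hx => hasActiveGradients_ballGradient hF h0 hg (hdiff x hx)
  exact ⟨S ∪ S', hS.union hS', fun x hx =>
    hd x (fun h => hx (Or.inl h)) fun h => hx (Or.inr h)⟩

/-! ### The maximal function as a supremum of averages -/

theorem setLAverage_ball_eq_ofReal_ballAvg {n : ℕ} {f : EuclideanSpace ℝ (Fin n) → ℝ}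
    (hf : Continuous f) (x : EuclideanSpace ℝ (Fin n)) {r : ℝ} (hr : 0 < r) :
    ⨍⁻ y in Metric.ball x r, ‖f y‖ₑ ∂volume = ENNReal.ofReal (ballAvg (fun y => |f y|) x r) := by
  have hae : Metric.ball x r =ᵐ[volume] Metric.closedBall x r :=
    ae_eq_of_subset_of_measure_ge Metric.ball_subset_closedBall
      (by rw [Measure.addHaar_closedBall volume x hr.le, Measure.addHaar_ball_of_pos volume x hr])
      Metric.isOpen_ball.measurableSet.nullMeasurableSet measure_closedBall_lt_top.ne
  have hpos : 0 < volume.real (Metric.closedBall x r) :=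
    ENNReal.toReal_pos (Metric.measure_closedBall_pos _ _ hr).ne' measure_closedBall_lt_top.ne
  have havg : ballAvg (fun y => |f y|) x r = ⨍ y in Metric.closedBall x r, |f y| := by
    rw [setAverage_eq, ← mul_ballAvg _ x hr, smul_eq_mul, inv_mul_cancel_left₀ hpos.ne']
  rw [setLAverage_congr hae, havg, ofReal_setAverage
    (hf.abs.continuousOn.integrableOn_compact (isCompact_closedBall _ _))
    (Eventually.of_forall fun y => abs_nonneg (f y)), setLAverage_eq]
  simp only [← Real.enorm_eq_ofReal_abs]

theorem maximalFunction_eq_iSup_ballAvg {n : ℕ} {f : EuclideanSpace ℝ (Fin n) → ℝ}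
    (hf : Continuous f) (x : EuclideanSpace ℝ (Fin n)) :
    maximalFunction f x = ⨆ (r : ℝ) (_ : 0 < r), ENNReal.ofReal (ballAvg (fun y => |f y|) x r) :=
  iSup_congr fun _ => iSup_congr fun hr => setLAverage_ball_eq_ofReal_ballAvg hf x hr

theorem ballAvg_le_toReal_maximalFunction {n : ℕ} {f : EuclideanSpace ℝ (Fin n) → ℝ}
    (hf : Continuous f) {x : EuclideanSpace ℝ (Fin n)} (hx : maximalFunction f x ≠ ∞) {r : ℝ}
    (hr : 0 < r) : ballAvg (fun y => |f y|) x r ≤ (maximalFunction f x).toReal := by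
  refine (ENNReal.ofReal_le_iff_le_toReal hx).1 ?_
  rw [maximalFunction_eq_iSup_ballAvg hf]
  exact le_iSup₂_of_le r hr le_rfl

theorem isLUB_toReal_maximalFunction {n : ℕ} {f : EuclideanSpace ℝ (Fin n) → ℝ}
    (hf : Continuous f) {x : EuclideanSpace ℝ (Fin n)} (hx : maximalFunction f x ≠ ∞) :
    IsLUB (ballAvg (fun y => |f y|) x '' Set.Ioi 0) (maximalFunction f x).toReal := by
  constructor
  · rintro _ ⟨r, hr, rfl⟩
    exact ballAvg_le_toReal_maximalFunction hf hx hr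
  · intro b hb
    have hle : ∀ r : ℝ, 0 < r → ballAvg (fun y => |f y|) x r ≤ b := fun r hr => hb ⟨r, hr, rfl⟩
    -- Nonnegativity of the bound is needed since `ENNReal.ofReal` truncates at `0`.
    have hb0 : 0 ≤ b := by
      refine le_trans ?_ (hle 1 one_pos)
      rw [← ballAvg_const (0 : ℝ) x 1]
      exact ballAvg_mono continuous_const hf.abs zero_le_one fun z _ => abs_nonneg _
    refine ENNReal.toReal_le_of_le_ofReal hb0 ?_
    rw [maximalFunction_eq_iSup_ballAvg hf]
    exact iSup₂_le fun r hr => ENNReal.ofReal_le_ofReal (hle r hr)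

/-- Radii up to `1` are handled by continuity on the compact `[0, 1]`, larger ones by comparison
with balls about `x₀`. -/
theorem maximalFunction_ne_top_of_ne_top {n : ℕ} {f : EuclideanSpace ℝ (Fin n) → ℝ}
    (hf : Continuous f) {x₀ : EuclideanSpace ℝ (Fin n)} (hx₀ : maximalFunction f x₀ ≠ ∞)
    (x : EuclideanSpace ℝ (Fin n)) : maximalFunction f x ≠ ∞ := by
  have hA : Continuous fun r : ℝ => ballAvg (fun y => |f y|) x r :=
    (continuous_ballAvg hf.abs).comp (by fun_prop : Continuous fun r : ℝ => (x, r))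
  obtain ⟨C, hC⟩ := (isCompact_Icc (a := (0 : ℝ)) (b := 1)).bddAbove_image hA.continuousOn
  set D : ℝ := (1 + dist x x₀) ^ Module.finrank ℝ (EuclideanSpace ℝ (Fin n)) *
    (maximalFunction f x₀).toReal
  refine ne_top_of_le_ne_top (ENNReal.ofReal_ne_top (r := max C D)) ?_
  rw [maximalFunction_eq_iSup_ballAvg hf]
  refine iSup₂_le fun r hr => ENNReal.ofReal_le_ofReal ?_
  rcases le_or_gt r 1 with h1 | h1
  · exact (hC ⟨r, ⟨hr.le, h1⟩, rfl⟩).trans (le_max_left _ _)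
  · refine le_trans ?_ (le_max_right _ _)
    refine (ballAvg_le_mul_ballAvg hf.abs (fun z => abs_nonneg _) x₀ x hr).trans ?_
    have h2 : dist x x₀ / r ≤ dist x x₀ := div_le_self dist_nonneg h1.le
    calc _ ≤ (1 + dist x x₀ / r) ^ Module.finrank ℝ (EuclideanSpace ℝ (Fin n)) *
          (maximalFunction f x₀).toReal :=
          mul_le_mul_of_nonneg_left (ballAvg_le_toReal_maximalFunction hf hx₀ (by positivity))
            (by positivity)
      _ ≤ D := by simp only [D]; gcongr

theorem theorem1p2 {n : ℕ} (hn : 1 ≤ n) (f : EuclideanSpace ℝ (Fin n) → ℝ)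
    (hf : Continuous f)
    (hdiff : ∃ E : Set (EuclideanSpace ℝ (Fin n)), IsSigmaTangential E ∧
      ∀ x, x ∉ E → DifferentiableAt ℝ f x)
    (hM : ∃ x, maximalFunction f x ≠ ∞) :
    (∀ x, maximalFunction f x ≠ ∞) ∧
      Continuous (fun x => (maximalFunction f x).toReal) ∧
      ∃ E : Set (EuclideanSpace ℝ (Fin n)), IsSigmaTangential E ∧
        ∀ x, x ∉ E → DifferentiableAt ℝ (fun x => (maximalFunction f x).toReal) x := by
  obtain ⟨x₀, hx₀⟩ := hM
  obtain ⟨S, hS, hSd⟩ := hdiff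
  obtain ⟨S', hS', hSd'⟩ := exists_isSigmaTangential_differentiableAt_abs hn hS hSd
  have hfin := maximalFunction_ne_top_of_ne_top hf hx₀
  have hlub := fun x => isLUB_toReal_maximalFunction hf (hfin x)
  exact ⟨hfin, continuous_of_isLUB_ballAvg hf.abs (fun z => abs_nonneg _) hlub,
    exists_isSigmaTangential_of_isLUB_ballAvg hn hf.abs (fun z => abs_nonneg _) hlub hS' hSd'⟩
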